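/- Let $b\ge 2$ and $m\ge 1$ be integers with $m\nmid (b-1)$, let $\Sigma$ be an alphabet of $m$ letters, $\sigma$ a cyclic permutation of $\Sigma$, and $\overline{\alpha}\in\Sigma$. Let $\mu$ be the morphism of $\Sigma^*$ with $\mu(\alpha)=\sigma^0(\alpha)\sigma^1(\alpha)\cdots\sigma^{b-1}(\alpha)$ for $\alpha\in\Sigma$, and let $\mathbf t=\lim_{n\to\infty}\mu^n(\overline{\alpha})$ be the generalized Thue-Morse word. For a finite word $w$ and a rational $r\ge 0$ with $r|w|\in\mathbb N$, let $w^r=w^{\lfloor r\rfloor}p$, where $p$ is the prefix of $w$ of length $(r-\lfloor r\rfloor)|w|$. The index of a factor $w$ of $\mathbf t$ is the largest such $r$ for which $w^r$ is a factor of $\mathbf t$ ($\infty$ if there is no largest one), the critical exponent $e$ of $\mathbf t$ is the supremum of the indices of its nonempty factors, and a factor is critical if its index equals $e$. For $\ell\in\mathbb N$ let $\mathrm{Occ}(\ell)$ be the set of all positions $p\ge 0$ such that $w^e$ occurs in $\mathbf t$ at position $p$ for some critical factor $w$ of length $\ell$. For $g,x,y\in\mathbb Z$ let $S^{g}_{x,y}$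 be the set of integers $s\ge 1$ such that $g=sx+ty$ for some $t\in\mathbb Z$, and let $$A=\{kb^q-b \mid k\ge 1,\ b\nmid k,\ q\in S^{m}_{b-1,m}\},$$ $$B_N=\{kb^q-N\mid k\ge 1,\ b\nmid k,\ q\in S^{N}_{b-1,m}\},$$ $$C=(8B_1+3)\cup(8B_1+7).$$ Let $w$ be a critical factor of $\mathbf t$ of length $\ell=Nb^i$ with $b\nmid N$. Then: - if $b>m$, then $\mathrm{Occ}(\ell)=b^iA$; - if $b\le m$ and $(b,m)\ne(2,2)$, then $\mathrm{Occ}(\ell)=b^iB_N$; - if $b=m=2$, then $\bigcup_{M\ge 1,\ b\nmid M}\mathrm{Occ}(Mb^i)=b^i(B_1\cup C)$; more precisely, either $N=1$ and $\mathrm{Occ}(\ell)=b^iB_1$, or $N=3$ and $\mathrm{Occ}(\ell)=b^iC$. -/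

import Mathlib

open scoped NNReal ENNReal

namespace ThueMorse

section Words

variable {A : Type*}

/-- The finite word `w` occurs in the infinite word `x` at position `p`. -/
def OccursAt (x : ℕ → A) (p : ℕ) (w : List A) : Prop :=
  ∀ (j : ℕ) (hj : j < w.length), x (p + j) = w[j]

/-- The finite word `w` is a factor of the infinite word `x`. -/
def IsFactor (x : ℕ → A) (w : List A) : Prop :=
  ∃ p, OccursAt x p w

/-- `r` is an admissible exponent for `w`: the number `r * |w|` is a natural number. -/
def IsExponent (w : List A) (r : ℚ≥0) : Prop :=
  ∃ n : ℕ, r * (w.length : ℚ≥0) = (n : ℚ≥0)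

/-- The rational power `w ^ r`: the word `w` repeated `⌊r⌋` times, followed by the prefix of `w`
of length `(r - ⌊r⌋) * |w|`. It is used only for `r` with `IsExponent w r`, where this length is
a natural number. -/
def ratPow (w : List A) (r : ℚ≥0) : List A :=
  (List.replicate ⌊r⌋₊ w).flatten ++ w.take ⌊(r - (⌊r⌋₊ : ℚ≥0)) * (w.length : ℚ≥0)⌋₊

/-- The index of `w` in `x`: the largest admissible `r` such that `w ^ r` is a factor of `x`, and
`∞` if there is no largest one. For nonempty `w` the admissible exponents are multiples of
`1 / |w|`, so the supremum is a maximum when it is finite; for the empty word it is `∞`. -/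
noncomputable def index (x : ℕ → A) (w : List A) : ℝ≥0∞ :=
  ⨆ (r : ℚ≥0) (_ : IsExponent w r ∧ IsFactor x (ratPow w r)), ((r : ℝ≥0) : ℝ≥0∞)

/-- The critical exponent of `x`: the supremum of the indices of the nonempty factors of `x`. -/
noncomputable def criticalExponent (x : ℕ → A) : ℝ≥0∞ :=
  ⨆ (w : List A) (_ : IsFactor x w ∧ w ≠ []), index x w

/-- `w` is a critical factor of `x`: a factor whose index is the critical exponent of `x`. -/
def IsCriticalFactor (x : ℕ → A) (w : List A) : Prop :=
  IsFactor x w ∧ index x w = criticalExponent x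

/-- The set of occurrences in `x` of the power `w ^ e`, where `e` is the critical exponent
of `x`. -/
def criticalPowerOccurrences (x : ℕ → A) (w : List A) : Set ℕ :=
  {p | ∃ r : ℚ≥0, ((r : ℝ≥0) : ℝ≥0∞) = criticalExponent x ∧ IsExponent w r ∧
    OccursAt x p (ratPow w r)}

/-- The set of positions of `x` at which the critical exponent is realized by a critical factor
of length `l`: the union, over the critical factors `w` of length `l`, of the sets of occurrences
of `w ^ e`. -/
def criticalOccurrences (x : ℕ → A) (l : ℕ) : Set ℕ :=
  {p | ∃ w : List A, IsCriticalFactor x w ∧ w.length = l ∧ p ∈ criticalPowerOccurrences x w}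

end Words

section Morphism

variable {A : Type*}

/-- The morphism `μ` with `μ(a) = σ^0(a) σ^1(a) ⋯ σ^(b-1)(a)` on letters. -/
def mu (b : ℕ) (σ : Equiv.Perm A) (w : List A) : List A :=
  w.flatMap fun a => (List.range b).map fun i => (σ ^ i) a

/-- The generalized Thue-Morse word `μ^ω(a)`, the limit of the words `μ^n(a)`. Since `μ^n(a)` has
length `b ^ n > n` for `b ≥ 2`, its letter at position `n` exists; the words `μ^n(a)` are all
prefixes of the word defined here, see `occursAt_word`. -/
def word (b : ℕ) (σ : Equiv.Perm A) (a : A) (n : ℕ) : A :=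
  ((mu b σ)^[n] [a]).getD n a

theorem length_mu (b : ℕ) (σ : Equiv.Perm A) (w : List A) :
    (mu b σ w).length = b * w.length := by
  simp [mu, List.length_flatMap, mul_comm]

theorem length_iterate_mu (b : ℕ) (σ : Equiv.Perm A) (a : A) (n : ℕ) :
    ((mu b σ)^[n] [a]).length = b ^ n := by
  induction n with
  | zero => simp
  | succ n ih => rw [Function.iterate_succ_apply', length_mu, ih, pow_succ, mul_comm]

theorem mu_prefix (b : ℕ) (σ : Equiv.Perm A) {u v : List A} (h : u <+: v) :
    mu b σ u <+: mu b σ v := by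
  obtain ⟨s, rfl⟩ := h
  exact ⟨mu b σ s, by simp [mu]⟩

theorem iterate_mu_prefix (b : ℕ) (hb : 2 ≤ b) (σ : Equiv.Perm A) (a : A) {n k : ℕ}
    (h : n ≤ k) : (mu b σ)^[n] [a] <+: (mu b σ)^[k] [a] := by
  have step : ∀ j, (mu b σ)^[j] [a] <+: (mu b σ)^[j + 1] [a] := by
    intro j
    induction j with
    | zero =>
      obtain ⟨c, rfl⟩ : ∃ c, b = c + 1 := ⟨b - 1, by omega⟩
      simp [mu, List.range_succ_eq_map]
    | succ j ih =>
      rw [Function.iterate_succ_apply', Function.iterate_succ_apply' _ (j + 1)]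
      exact mu_prefix b σ ih
  induction h with
  | refl => exact List.prefix_rfl
  | step _ ih => exact ih.trans (step _)

/-- Each `μ^n(a)` is a prefix of `word b σ a`. -/
theorem occursAt_word (b : ℕ) (hb : 2 ≤ b) (σ : Equiv.Perm A) (a : A) (n : ℕ) :
    OccursAt (word b σ a) 0 ((mu b σ)^[n] [a]) := by
  intro j hj
  have hj' : j < ((mu b σ)^[j] [a]).length := by
    rw [length_iterate_mu]
    exact Nat.lt_pow_self (by omega)
  rw [zero_add, word, List.getD_eq_getElem _ _ hj']
  rcases le_total n j with h | h
  · exact ((iterate_mu_prefix b hb σ a h).getElem hj).symm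
  · exact (iterate_mu_prefix b hb σ a h).getElem hj'

end Morphism

/-- The set `S^g_{x,y}` of the positive integers `s` such that `g = s x + t y` for some
integer `t`. -/
def bezoutSet (g x y : ℤ) : Set ℕ :=
  {s | 0 < s ∧ ∃ t : ℤ, g = (s : ℤ) * x + t * y}

/-- The set `A` of the numbers `k b^q - b` with `k ≥ 1`, `b ∤ k` and `q ∈ S^m_{b-1,m}`. -/
def setA (b m : ℕ) : Set ℕ :=
  {n | ∃ k q : ℕ, 0 < k ∧ ¬ b ∣ k ∧ q ∈ bezoutSet (m : ℤ) ((b : ℤ) - 1) (m : ℤ) ∧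
    (n : ℤ) = (k : ℤ) * (b : ℤ) ^ q - (b : ℤ)}

/-- The set `B_N` of the numbers `k b^q - N` with `k ≥ 1`, `b ∤ k` and `q ∈ S^N_{b-1,m}`. -/
def setB (b m N : ℕ) : Set ℕ :=
  {n | ∃ k q : ℕ, 0 < k ∧ ¬ b ∣ k ∧ q ∈ bezoutSet (N : ℤ) ((b : ℤ) - 1) (m : ℤ) ∧
    (n : ℤ) = (k : ℤ) * (b : ℤ) ^ q - (N : ℤ)}

/-- The set `C = (8 B_1 + 3) ∪ (8 B_1 + 7)`. -/
def setC (b m : ℕ) : Set ℕ :=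
  (fun n => 8 * n + 3) '' setB b m 1 ∪ (fun n => 8 * n + 7) '' setB b m 1

/-- The set `c · S = {c n | n ∈ S}`. -/
def dilate (c : ℕ) (S : Set ℕ) : Set ℕ :=
  (fun n => c * n) '' S

end ThueMorse

/-!
The letter of `word b σ a` at position `n` is `σ ^ s a`, where `s` is the sum of the base-`b` digits
of `n` (`word_eq`). Since `σ` is a full cycle on `m` letters, the word may be replaced by
`digitSumMod b m`, the digit sum modulo `m`. Its increments are explicit (`digitSumMod_succ`): if
`n + 1 = k * b ^ q` with `b ∤ k`, the step from `n` to `n + 1` is `1 - (b - 1) * q`. As `m ∤ b - 1`,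
the step is never `1` when `q = 1`, so a step `1` at a multiple of `b` forces a multiple of `b ^ 2`.

A power is recorded as `HasPeriod x p K l`: the letters at `p + j` and `p + j + l` agree for `j < K`,
so that a factor of length `K + l` has period `l`. If the length of all such factors is at most
`c / d * l`, with equality for some `l`, then `c / d` is the critical exponent, and the occurrences
in question are the `extremalPositions`, where equality holds.

Whether the letters at `n` and `n + b * l` agree depends only on `n / b`; hence dividing by `b`
reduces everything to periods `l` with `b ∤ l` (`isPeriodBound_of_not_dvd`,
`extremalPositions_mul_pow`). For such `l`, the increments at `n` and `n + l` agree inside the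
factor, and at most one of `n`, `n + l` is a multiple of `b`, so both increments are `1`.

* If `K > l`, all increments inside the factor are `1`. Then `m ∣ l`, and the factor cannot
  contain two consecutive multiples of `b` past its first letter, whence `K + l ≤ 2 * b`. This gives
  the critical exponent `2 * b / m` when `m < b`, attained only for `l = m` and around a
  multiple `p + b = k * b ^ q` of `b` at which the increment is `1`. It gives `K ≤ l`, hence the
  exponent `2`, when `b ≤ m`.
* If `K = l`, all increments but the middle one are `1`, and as they add up to `0` over a period,
  the middle `p + l = k * b ^ q` satisfies `(b - 1) * q ≡ l` modulo `m` (`HasPeriod.mul_eq`). For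
  `l > b` the multiples of `b` next to the middle leave only `b = m = 2` and `l = 3`
  (`HasPeriod.eq_of_lt`).
-/

open scoped NNReal ENNReal

namespace ThueMorse

/-! ### Periods and critical powers -/

section Periods

variable {A : Type*} (x : ℕ → A)

/-- The factor of `x` of length `K + l` at position `p` has period `l`. -/
def HasPeriod (p K l : ℕ) : Prop :=
  ∀ j < K, x (p + j) = x (p + j + l)

/-- Every factor of `x` with a period `l > 0` has length at most `c / d * l`. -/
def IsPeriodBound (c d : ℕ) : Prop :=
  ∀ p K l, 0 < l → HasPeriod x p K l → d * (K + l) ≤ c * l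

/-- The positions `p` at which `x` has a factor with period `l` and length `c / d * l`. -/
def extremalPositions (c d l : ℕ) : Set ℕ :=
  {p | ∃ K, HasPeriod x p K l ∧ d * (K + l) = c * l}

variable {x}

theorem getElem?_flatten_replicate (w : List A) (n j : ℕ) (hj : j < n * w.length) :
    (List.replicate n w).flatten[j]? = w[j % w.length]? := by
  induction n generalizing j with
  | zero => simp at hj
  | succ n ih =>
    rw [List.replicate_succ, List.flatten_cons]
    rcases lt_or_ge j w.length with h | h
    · rw [List.getElem?_append_left h, Nat.mod_eq_of_lt h]
    · rw [List.getElem?_append_right h, ih _ (by rw [add_mul] at hj; omega),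
        ← Nat.mod_eq_sub_mod h]

theorem ratPow_eq {w : List A} (hw : 0 < w.length) {r : ℚ≥0} {n : ℕ}
    (hr : r * (w.length : ℚ≥0) = n) :
    ratPow w r = (List.replicate (n / w.length) w).flatten ++ w.take (n % w.length) := by
  have hl : (w.length : ℚ≥0) ≠ 0 := by positivity
  have hr' : r = (n : ℚ≥0) / (w.length : ℚ≥0) := by rw [eq_div_iff hl, hr]
  have hf : ⌊r⌋₊ = n / w.length := by rw [hr', Nat.floor_div_eq_div]
  have hn : (n : ℚ≥0) = (n / w.length : ℕ) * (w.length : ℚ≥0) + (n % w.length : ℕ) := by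
    rw [mul_comm]; exact_mod_cast (Nat.div_add_mod n w.length).symm
  rw [ratPow, hf, tsub_mul, hr]
  congr 2
  rw [tsub_eq_of_eq_add_rev hn, Nat.floor_natCast]

theorem length_ratPow {w : List A} (hw : 0 < w.length) {r : ℚ≥0} {n : ℕ}
    (hr : r * (w.length : ℚ≥0) = n) : (ratPow w r).length = n := by
  have := Nat.mod_lt n hw
  rw [ratPow_eq hw hr]
  simp only [List.length_append, List.length_flatten, List.map_replicate, List.sum_replicate,
    List.length_take, smul_eq_mul, min_eq_left this.le]
  exact Nat.div_add_mod' n w.length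

theorem getElem?_ratPow {w : List A} (hw : 0 < w.length) {r : ℚ≥0} {n : ℕ}
    (hr : r * (w.length : ℚ≥0) = n) {j : ℕ} (hj : j < n) :
    (ratPow w r)[j]? = w[j % w.length]? := by
  have hlen : (List.replicate (n / w.length) w).flatten.length = n / w.length * w.length := by
    simp
  rw [ratPow_eq hw hr]
  rcases lt_or_ge j (n / w.length * w.length) with h | h
  · rw [List.getElem?_append_left (by rwa [hlen]), getElem?_flatten_replicate w _ _ h]
  · have h1 := Nat.div_add_mod' n w.length
    have h2 := Nat.mod_lt n hw
    have h3 : j % w.length = j - n / w.length * w.length := by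
      conv_lhs => rw [← Nat.sub_add_cancel h]
      rw [Nat.add_mul_mod_self_right, Nat.mod_eq_of_lt (by omega)]
    rw [List.getElem?_append_right (by rwa [hlen]), hlen, h3,
      List.getElem?_take_of_lt (by omega)]

theorem occursAt_iff_getElem? {p : ℕ} {w : List A} :
    OccursAt x p w ↔ ∀ j < w.length, w[j]? = some (x (p + j)) := by
  constructor
  · intro h j hj
    rw [List.getElem?_eq_getElem hj, h j hj]
  · intro h j hj
    have := h j hj
    rw [List.getElem?_eq_getElem hj] at this
    exact (Option.some.inj this).symm

theorem HasPeriod.of_occursAt_ratPow {w : List A} (hw : 0 < w.length) {r : ℚ≥0} {p K : ℕ}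
    (hr : r * (w.length : ℚ≥0) = (K + w.length : ℕ)) (h : OccursAt x p (ratPow w r)) :
    HasPeriod x p K w.length := by
  intro j hj
  rw [occursAt_iff_getElem?, length_ratPow hw hr] at h
  have h1 := h j (by omega)
  have h2 := h (j + w.length) (by omega)
  rw [getElem?_ratPow hw hr (by omega)] at h1 h2
  rw [Nat.add_mod_right, h1, ← add_assoc] at h2
  exact Option.some.inj h2

/-- A factor of length `K + l` with period `l` is the power of its prefix of length `l`. -/
theorem HasPeriod.occursAt_ratPow {p K l : ℕ} (hl : 0 < l) (h : HasPeriod x p K l) {r : ℚ≥0}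
    (hr : r * (l : ℚ≥0) = (K + l : ℕ)) :
    OccursAt x p (ratPow ((List.range l).map fun j => x (p + j)) r) := by
  have hlen : ((List.range l).map fun j => x (p + j)).length = l := by simp
  have hmod : ∀ j < K + l, x (p + j % l) = x (p + j) := by
    intro j
    induction j using Nat.strong_induction_on with
    | _ j ih =>
      intro hj
      rcases lt_or_ge j l with h1 | h1
      · rw [Nat.mod_eq_of_lt h1]
      · have := h (j - l) (by omega)
        rw [show p + (j - l) + l = p + j by omega] at this
        rw [← this, ← ih (j - l) (by omega) (by omega), ← Nat.mod_eq_sub_mod h1]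
  have hr' : r * ((((List.range l).map fun j => x (p + j)).length : ℕ) : ℚ≥0) = (K + l : ℕ) := by
    rw [hlen, hr]
  have hpos : 0 < ((List.range l).map fun j => x (p + j)).length := by rwa [hlen]
  rw [occursAt_iff_getElem?, length_ratPow hpos hr']
  intro j hj
  rw [getElem?_ratPow hpos hr' hj, hlen]
  have := Nat.mod_lt j hl
  simp [this, hmod j hj]

theorem IsPeriodBound.exponent_le {c d : ℕ} (hdc : d ≤ c) (hle : IsPeriodBound x c d)
    {w : List A} (hw : 0 < w.length) {r : ℚ≥0} {n : ℕ} (hr : r * (w.length : ℚ≥0) = n)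
    (h : IsFactor x (ratPow w r)) : d * n ≤ c * w.length := by
  obtain ⟨p, hp⟩ := h
  rcases le_total n w.length with h1 | h1
  · exact Nat.mul_le_mul hdc h1
  · obtain ⟨K, rfl⟩ := Nat.exists_eq_add_of_le' h1
    exact hle p K _ hw (HasPeriod.of_occursAt_ratPow hw hr hp)

theorem coe_le_coe {r s : ℚ≥0} : ((r : ℝ≥0) : ℝ≥0∞) ≤ ((s : ℝ≥0) : ℝ≥0∞) ↔ r ≤ s := by
  rw [ENNReal.coe_le_coe, NNRat.cast_le]

theorem coe_inj {r s : ℚ≥0} : ((r : ℝ≥0) : ℝ≥0∞) = ((s : ℝ≥0) : ℝ≥0∞) ↔ r = s := by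
  rw [ENNReal.coe_inj, NNRat.cast_inj]

theorem IsPeriodBound.index_le {c d : ℕ} (hd : 0 < d) (hdc : d ≤ c) (hle : IsPeriodBound x c d)
    {w : List A} (hw : 0 < w.length) :
    index x w ≤ (((c / d : ℚ≥0) : ℝ≥0) : ℝ≥0∞) := by
  refine iSup₂_le fun r ⟨⟨n, hr⟩, h⟩ => coe_le_coe.2 ?_
  have h1 := hle.exponent_le hdc hw hr h
  have h2 : (d : ℚ≥0) * n ≤ c * w.length := by exact_mod_cast h1
  have hd' : (0 : ℚ≥0) < d := by exact_mod_cast hd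
  have hw' : (0 : ℚ≥0) < w.length := by exact_mod_cast hw
  rw [le_div_iff₀ hd']
  refine le_of_mul_le_mul_right ?_ hw'
  rwa [mul_right_comm, hr, mul_comm]

theorem div_mul_eq_iff {c d l n : ℕ} (hd : 0 < d) :
    (c / d : ℚ≥0) * l = n ↔ d * n = c * l := by
  have hd' : (d : ℚ≥0) ≠ 0 := by positivity
  rw [div_mul_eq_mul_div, div_eq_iff hd', mul_comm (n : ℚ≥0), eq_comm]
  exact_mod_cast Iff.rfl

/-- At a position where the period bound is attained, the prefix of length `l` of the periodic
factor has index at least `c / d`. -/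
theorem exists_of_mem_extremalPositions {c d l p : ℕ} (hd : 0 < d) (hl : 0 < l)
    (h : p ∈ extremalPositions x c d l) :
    ∃ w : List A, IsFactor x w ∧ w.length = l ∧ (((c / d : ℚ≥0) : ℝ≥0) : ℝ≥0∞) ≤ index x w ∧
      IsExponent w (c / d) ∧ OccursAt x p (ratPow w (c / d)) := by
  obtain ⟨K, hK, he⟩ := h
  have hr := (div_mul_eq_iff hd).2 he
  have hocc := hK.occursAt_ratPow hl hr
  have hexp : IsExponent ((List.range l).map fun j => x (p + j)) (c / d) :=
    ⟨K + l, by simpa using hr⟩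
  refine ⟨(List.range l).map fun j => x (p + j), ⟨p, ?_⟩, by simp, ?_, hexp, hocc⟩
  · intro j hj
    simp
  · exact le_iSup₂_of_le (c / d : ℚ≥0) ⟨hexp, p, hocc⟩ le_rfl

theorem IsPeriodBound.criticalExponent_eq {c d l : ℕ} (hd : 0 < d) (hdc : d ≤ c)
    (hle : IsPeriodBound x c d) (hl : 0 < l) (hne : (extremalPositions x c d l).Nonempty) :
    criticalExponent x = (((c / d : ℚ≥0) : ℝ≥0) : ℝ≥0∞) := by
  apply le_antisymm
  · exact iSup₂_le fun w hw => hle.index_le hd hdc (List.length_pos_iff.2 hw.2)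
  · obtain ⟨p, hp⟩ := hne
    obtain ⟨w, hw, hwl, hi, -⟩ := exists_of_mem_extremalPositions hd hl hp
    refine hi.trans (le_iSup₂_of_le w ⟨hw, ?_⟩ le_rfl)
    rw [← List.length_pos_iff, hwl]
    exact hl

theorem IsPeriodBound.criticalOccurrences_eq {c d : ℕ} (hd : 0 < d) (hdc : d ≤ c)
    (hle : IsPeriodBound x c d)
    (he : criticalExponent x = (((c / d : ℚ≥0) : ℝ≥0) : ℝ≥0∞)) {l : ℕ} (hl : 0 < l) :
    criticalOccurrences x l = extremalPositions x c d l := by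
  ext p
  constructor
  · rintro ⟨w, -, rfl, r, hr, ⟨n, hn⟩, hocc⟩
    rw [he, coe_inj] at hr
    subst hr
    have h1 := (div_mul_eq_iff hd).1 hn
    have h2 : w.length ≤ n := by
      have := Nat.mul_le_mul_right w.length hdc
      rw [← h1] at this
      exact Nat.le_of_mul_le_mul_left this hd
    obtain ⟨K, rfl⟩ := Nat.exists_eq_add_of_le' h2
    exact ⟨K, HasPeriod.of_occursAt_ratPow hl hn hocc, h1⟩
  · intro hp
    obtain ⟨w, hw, rfl, hi, hexp, hocc⟩ := exists_of_mem_extremalPositions hd hl hp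
    exact ⟨w, ⟨hw, he ▸ le_antisymm (hle.index_le hd hdc hl) hi⟩, rfl,
      _, he.symm, hexp, hocc⟩

/-- The critical exponent is attained by every critical factor: the admissible exponents of a
word `w` lie in a discrete set, so `index x w` is a maximum. -/
theorem IsPeriodBound.extremalPositions_nonempty {c d : ℕ} (hd : 0 < d) (hdc : d ≤ c)
    (hle : IsPeriodBound x c d)
    (he : criticalExponent x = (((c / d : ℚ≥0) : ℝ≥0) : ℝ≥0∞)) {w : List A} (hw : 0 < w.length)
    (hcrit : IsCriticalFactor x w) : (extremalPositions x c d w.length).Nonempty := by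
  by_contra hempty
  have hd' : (0 : ℚ≥0) < d := by exact_mod_cast hd
  have hw' : (0 : ℚ≥0) < w.length := by exact_mod_cast hw
  have hpos : 0 < c * w.length := Nat.mul_pos (hd.trans_le hdc) hw
  -- `d * n < c * |w|` for every exponent `n / |w|`, hence `d * n ≤ c * |w| - 1`
  have hlt : index x w ≤
      ((((c * w.length - 1 : ℕ) / (d * w.length) : ℚ≥0) : ℝ≥0) : ℝ≥0∞) := by
    refine iSup₂_le fun r ⟨⟨n, hr⟩, h⟩ => coe_le_coe.2 ?_
    have h1 := hle.exponent_le hdc hw hr h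
    have h2 : d * n ≠ c * w.length := by
      intro h2
      have h3 : w.length ≤ n := by
        have := Nat.mul_le_mul_right w.length hdc
        rw [← h2] at this
        exact Nat.le_of_mul_le_mul_left this hd
      obtain ⟨K, rfl⟩ := Nat.exists_eq_add_of_le' h3
      obtain ⟨p, hp⟩ := h
      exact hempty ⟨p, K, HasPeriod.of_occursAt_ratPow hw hr hp, h2⟩
    have h3 : d * n ≤ c * w.length - 1 := by omega
    rw [le_div_iff₀ (mul_pos hd' hw'), mul_left_comm, hr]
    exact_mod_cast h3
  rw [hcrit.2, he, coe_le_coe, div_le_div_iff₀ hd' (mul_pos hd' hw')] at hlt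
  have h4 : c * (d * w.length) ≤ (c * w.length - 1) * d := by exact_mod_cast hlt
  rw [mul_left_comm, mul_comm] at h4
  have := Nat.le_of_mul_le_mul_right h4 hd
  omega

end Periods

/-! ### Digit sums -/

/-- The sum modulo `m` of the digits of `n` in base `b`. -/
def digitSumMod (b m n : ℕ) : ZMod m :=
  ((Nat.digits b n).sum : ZMod m)

theorem digits_sum_mul_add {b : ℕ} (hb : 2 ≤ b) (n : ℕ) {r : ℕ} (hr : r < b) :
    (Nat.digits b (b * n + r)).sum = (Nat.digits b n).sum + r := by
  rcases Nat.eq_zero_or_pos (b * n + r) with h | h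
  · have hr0 : r = 0 := by omega
    have hn : n = 0 := by
      have : b * n = 0 := by omega
      rcases Nat.mul_eq_zero.1 this with h | h <;> omega
    simp [hr0, hn]
  · rw [Nat.digits_def' (by omega) h, List.sum_cons, Nat.mul_add_mod, Nat.mod_eq_of_lt hr,
      Nat.mul_add_div (by omega), Nat.div_eq_of_lt hr, add_zero, add_comm]

theorem digitSumMod_mul_add {b : ℕ} (m : ℕ) (hb : 2 ≤ b) (n : ℕ) {r : ℕ} (hr : r < b) :
    digitSumMod b m (b * n + r) = digitSumMod b m n + r := by
  simp [digitSumMod, digits_sum_mul_add hb n hr]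

section Word

variable {A : Type*}

theorem getElem?_mu {b : ℕ} (σ : Equiv.Perm A) (w : List A) (n : ℕ) {r : ℕ} (hr : r < b) :
    (mu b σ w)[b * n + r]? = w[n]?.map (σ ^ r) := by
  induction w generalizing n with
  | nil => simp [mu]
  | cons c w ih =>
    have hcons : mu b σ (c :: w) = (List.range b).map (fun i => (σ ^ i) c) ++ mu b σ w := by
      simp [mu]
    have hlen : ((List.range b).map fun i => (σ ^ i) c).length = b := by simp
    rw [hcons]
    cases n with
    | zero =>
      rw [List.getElem?_append_left (by rw [hlen]; omega)]
      simp [hr]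
    | succ n =>
      rw [List.getElem?_append_right (by rw [hlen, mul_add]; omega), hlen,
        show b * (n + 1) + r - b = b * n + r by rw [mul_add]; omega, ih]
      simp

theorem getElem?_iterate_mu {b : ℕ} (hb : 2 ≤ b) (σ : Equiv.Perm A) (a : A) (N : ℕ) :
    ∀ n < b ^ N, ((mu b σ)^[N] [a])[n]? = some ((σ ^ (Nat.digits b n).sum) a) := by
  induction N with
  | zero =>
    intro n hn
    have : n = 0 := by simpa using hn
    simp [this]
  | succ N ih =>
    intro n hn
    have hr := Nat.mod_lt n (show b > 0 by omega)
    rw [Function.iterate_succ_apply', ← Nat.div_add_mod n b, getElem?_mu σ _ _ hr,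
      ih _ (Nat.div_lt_of_lt_mul (by rwa [pow_succ'] at hn)), digits_sum_mul_add hb _ hr,
      add_comm, pow_add]
    simp

theorem word_eq {b : ℕ} (hb : 2 ≤ b) (σ : Equiv.Perm A) (a : A) (n : ℕ) :
    word b σ a n = (σ ^ (Nat.digits b n).sum) a := by
  rw [word, List.getD_eq_getElem?_getD,
    getElem?_iterate_mu hb σ a n n (Nat.lt_pow_self (by omega)), Option.getD_some]

theorem hasPeriod_word_iff [Fintype A] {b m : ℕ} (hb : 2 ≤ b) (hA : Fintype.card A = m)
    {σ : Equiv.Perm A} (hσ : σ.IsCycleOn Set.univ) (a : A) {p K l : ℕ} :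
    HasPeriod (word b σ a) p K l ↔ HasPeriod (digitSumMod b m) p K l := by
  have hσ' : σ.IsCycleOn ((Finset.univ : Finset A) : Set A) := by simpa using hσ
  have key : ∀ i j, word b σ a i = word b σ a j ↔ digitSumMod b m i = digitSumMod b m j := by
    intro i j
    rw [word_eq hb, word_eq hb, hσ'.pow_apply_eq_pow_apply (Finset.mem_univ a),
      Finset.card_univ, hA, digitSumMod, digitSumMod, ZMod.natCast_eq_natCast_iff]
  simp only [HasPeriod, key]

end Word

section DigitSum

variable {b m : ℕ}

theorem digitSumMod_succ (hb : 2 ≤ b) {k : ℕ} (hk : ¬ b ∣ k) (q : ℕ) :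
    ∀ n, n + 1 = k * b ^ q →
      digitSumMod b m (n + 1) = digitSumMod b m n + 1 - ((b : ZMod m) - 1) * q := by
  induction q with
  | zero =>
    intro n hn
    have hr := Nat.mod_lt n (show b > 0 by omega)
    have hr' : n % b + 1 < b := by
      refine lt_of_le_of_ne hr fun h => hk ⟨n / b + 1, ?_⟩
      rw [pow_zero, mul_one] at hn
      rw [← hn, mul_add, mul_one]
      conv_lhs => rw [← Nat.div_add_mod n b, add_assoc, h]
    have h1 := digitSumMod_mul_add m hb (n / b) hr
    have h2 := digitSumMod_mul_add m hb (n / b) hr'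
    rw [← add_assoc, Nat.div_add_mod] at h2
    rw [Nat.div_add_mod] at h1
    rw [h1, h2]
    push_cast
    ring
  | succ q ih =>
    intro n hn
    have hpos : 0 < k * b ^ q := by
      rcases Nat.eq_zero_or_pos (k * b ^ q) with h | h
      · rw [pow_succ, ← mul_assoc, h] at hn
        omega
      · exact h
    obtain ⟨n', hn'⟩ := Nat.exists_eq_add_of_lt hpos
    rw [zero_add] at hn'
    have h1 : n + 1 = b * (n' + 1) + 0 := by rw [hn, ← hn']; ring
    have h2 : n = b * n' + (b - 1) := by rw [mul_add] at h1; omega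
    rw [h1, digitSumMod_mul_add m hb _ (by omega), ih n' hn'.symm]
    conv_rhs => rw [h2, digitSumMod_mul_add m hb _ (show b - 1 < b by omega)]
    rw [Nat.cast_sub (by omega)]
    push_cast
    ring

theorem digitSumMod_succ_of_not_dvd (hb : 2 ≤ b) {n : ℕ} (h : ¬ b ∣ n + 1) :
    digitSumMod b m (n + 1) = digitSumMod b m n + 1 := by
  rw [digitSumMod_succ hb h 0 n (by simp)]
  simp

theorem exists_eq_mul_pow (hb : 2 ≤ b) {n : ℕ} (hn : 0 < n) :
    ∃ k q, 0 < k ∧ ¬ b ∣ k ∧ n = k * b ^ q := by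
  obtain ⟨q, k, hk, h⟩ := Nat.exists_eq_pow_mul_and_not_dvd hn.ne' b (by omega)
  refine ⟨k, q, Nat.pos_of_ne_zero ?_, hk, by rw [h, mul_comm]⟩
  rintro rfl
  simp at hk

/-- Unit increments at multiples of `b` happen only at multiples of `b ^ 2`. -/
theorem sq_dvd_of_digitSumMod_succ (hb : 2 ≤ b) (haper : ¬ m ∣ b - 1) {n : ℕ} (hn : b ∣ n + 1)
    (h : digitSumMod b m (n + 1) = digitSumMod b m n + 1) : b ^ 2 ∣ n + 1 := by
  obtain ⟨k, q, -, hk, hkq⟩ := exists_eq_mul_pow hb (Nat.succ_pos n)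
  rw [digitSumMod_succ hb hk q n hkq, sub_eq_self] at h
  rcases q with - | - | q
  · rw [pow_zero, mul_one] at hkq
    exact absurd (hkq ▸ hn) hk
  · rw [← ZMod.natCast_eq_zero_iff, Nat.cast_sub (by omega)] at haper
    simp at h haper
    exact absurd h haper
  · rw [Nat.succ_eq_add_one] at hkq
    rw [hkq]
    exact Dvd.dvd.mul_left (pow_dvd_pow b (by omega)) k

theorem digitSumMod_add {p n : ℕ}
    (h : ∀ j < n, digitSumMod b m (p + j + 1) = digitSumMod b m (p + j) + 1) :
    digitSumMod b m (p + n) = digitSumMod b m p + n := by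
  induction n with
  | zero => simp
  | succ n ih =>
    rw [← add_assoc, h n (by omega), ih fun j hj => h j (by omega)]
    push_cast
    ring

theorem mem_bezoutSet_iff {g q : ℕ} :
    q ∈ bezoutSet (g : ℤ) ((b : ℤ) - 1) (m : ℤ) ↔
      0 < q ∧ ((b : ZMod m) - 1) * q = g := by
  have key : (((b : ZMod m) - 1) * q = g) ↔
      (((((b : ℤ) - 1) * q : ℤ) : ZMod m) = ((g : ℤ) : ZMod m)) := by
    push_cast
    exact Iff.rfl
  rw [key, ZMod.intCast_eq_intCast_iff_dvd_sub, bezoutSet]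
  refine and_congr_right fun _ => exists_congr fun t => ?_
  constructor <;> intro h <;> linarith

end DigitSum

variable {b m : ℕ}

/-! ### Periods divisible by the base -/

theorem digitSumMod_eq_iff_div (hb : 2 ≤ b) (n l : ℕ) :
    digitSumMod b m n = digitSumMod b m (n + b * l) ↔
      digitSumMod b m (n / b) = digitSumMod b m (n / b + l) := by
  have hr := Nat.mod_lt n (show b > 0 by omega)
  have h1 := digitSumMod_mul_add m hb (n / b) hr
  have h2 := digitSumMod_mul_add m hb (n / b + l) hr
  rw [Nat.div_add_mod] at h1
  rw [show b * (n / b + l) + n % b = n + b * l by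
    conv_rhs => rw [← Nat.div_add_mod n b]
    ring] at h2
  rw [h1, h2, add_left_inj]

/-- The positions `n` at which the letters at `n` and `n + b * l` agree form a union of blocks
`[b * n', b * (n' + 1))`; those blocks that meet `[p, p + K)` are numbered `p / b + j` with
`j < K'`. -/
theorem HasPeriod.exists_div (hb : 2 ≤ b) {p K l : ℕ} (hK : 0 < K)
    (h : HasPeriod (digitSumMod b m) p K (b * l)) :
    ∃ K', HasPeriod (digitSumMod b m) (p / b) K' l ∧ p + K ≤ b * (p / b) + b * K' := by
  have hb0 : 0 < b := by omega
  refine ⟨(p + K + (b - 1)) / b - p / b, fun j hj => ?_, ?_⟩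
  · -- the block `p / b + j` meets the interval `[p, p + K)` at `max p (b * (p / b + j))`
    have hj1 : p / b + j < (p + K + (b - 1)) / b := by omega
    have hj2 : b * (p / b + j + 1) ≤ p + K + (b - 1) := by
      rw [mul_comm]; exact (Nat.le_div_iff_mul_le hb0).1 hj1
    have hp := Nat.div_add_mod p b
    have hp' := Nat.mod_lt p hb0
    rcases Nat.eq_zero_or_pos j with rfl | hjpos
    · have := h 0 hK
      rwa [add_zero, digitSumMod_eq_iff_div hb] at this
    · obtain ⟨i, hi⟩ : ∃ i, b * (p / b + j) = p + i := by
        refine Nat.exists_eq_add_of_le ?_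
        have : b * 1 ≤ b * j := Nat.mul_le_mul_left b hjpos
        rw [mul_add]
        omega
      have := h i (by rw [mul_add b _ 1] at hj2; omega)
      rw [← hi, digitSumMod_eq_iff_div hb, Nat.mul_div_cancel_left _ hb0] at this
      exact this
  · have h1 := Nat.div_add_mod (p + K + (b - 1)) b
    have h2 := Nat.mod_lt (p + K + (b - 1)) hb0
    have h3 : p / b ≤ (p + K + (b - 1)) / b := Nat.div_le_div_right (by omega)
    rw [← mul_add, Nat.add_sub_cancel' h3]
    omega

theorem HasPeriod.mul (hb : 2 ≤ b) {p K l : ℕ} (h : HasPeriod (digitSumMod b m) p K l) :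
    HasPeriod (digitSumMod b m) (b * p) (b * K) (b * l) := by
  intro j hj
  rw [digitSumMod_eq_iff_div hb, Nat.mul_add_div (by omega)]
  exact h _ (Nat.div_lt_of_lt_mul hj)

theorem isPeriodBound_of_not_dvd (hb : 2 ≤ b) {c d : ℕ} (hdc : d ≤ c)
    (h : ∀ p K l, ¬ b ∣ l → HasPeriod (digitSumMod b m) p K l → d * (K + l) ≤ c * l) :
    IsPeriodBound (digitSumMod b m) c d := by
  intro p K l hl
  induction l using Nat.strong_induction_on generalizing p K with
  | _ l ih =>
    intro hper
    rcases Nat.eq_zero_or_pos K with rfl | hK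
    · rw [zero_add]
      exact Nat.mul_le_mul_right l hdc
    by_cases hbl : b ∣ l
    · obtain ⟨l', rfl⟩ := hbl
      have hl' : 0 < l' := Nat.pos_of_mul_pos_left hl
      obtain ⟨K', hK', hle⟩ := hper.exists_div hb hK
      have h1 := ih l' (by nlinarith) _ _ hl' hK'
      have h2 : K ≤ b * K' := by have := Nat.mul_div_le p b; omega
      calc d * (K + b * l') ≤ d * (b * K' + b * l') := by gcongr
        _ = b * (d * (K' + l')) := by ring
        _ ≤ b * (c * l') := by gcongr
        _ = c * (b * l') := by ring
    · exact h p K l hbl hper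

theorem extremalPositions_mul (hb : 2 ≤ b) {c d : ℕ} (hd : 0 < d) (hdc : d < c)
    (h : IsPeriodBound (digitSumMod b m) c d) {l : ℕ} (hl : 0 < l) :
    extremalPositions (digitSumMod b m) c d (b * l) =
      dilate b (extremalPositions (digitSumMod b m) c d l) := by
  have hb0 : 0 < b := by omega
  ext p
  constructor
  · rintro ⟨K, hK, he⟩
    have hpos : 0 < K := by
      rcases Nat.eq_zero_or_pos K with rfl | hpos
      · have hbl : 0 < b * l := Nat.mul_pos hb0 hl
        rw [zero_add] at he
        exact absurd (Nat.eq_of_mul_eq_mul_right hbl he) hdc.ne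
      · exact hpos
    obtain ⟨K', hK', hle⟩ := hK.exists_div hb hpos
    have h1 := h _ _ _ hl hK'
    have h2 : b * K' ≤ K := by
      have : d * (b * K' + b * l) ≤ d * (K + b * l) := by
        calc d * (b * K' + b * l) = b * (d * (K' + l)) := by ring
          _ ≤ b * (c * l) := by gcongr
          _ = d * (K + b * l) := by rw [he]; ring
      have := Nat.le_of_mul_le_mul_left this hd
      omega
    have h3 := Nat.mul_div_le p b
    have h4 : K = b * K' := by omega
    refine ⟨p / b, ⟨K', hK', ?_⟩, by dsimp only; omega⟩
    refine Nat.eq_of_mul_eq_mul_left hb0 ?_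
    rw [h4] at he
    linarith
  · rintro ⟨p, ⟨K, hK, he⟩, rfl⟩
    refine ⟨b * K, hK.mul hb, ?_⟩
    rw [← mul_add, mul_left_comm, he, mul_left_comm]

theorem extremalPositions_mul_pow (hb : 2 ≤ b) {c d : ℕ} (hd : 0 < d) (hdc : d < c)
    (h : IsPeriodBound (digitSumMod b m) c d) {l : ℕ} (hl : 0 < l) (i : ℕ) :
    extremalPositions (digitSumMod b m) c d (l * b ^ i) =
      dilate (b ^ i) (extremalPositions (digitSumMod b m) c d l) := by
  induction i with
  | zero => simp [dilate]
  | succ i ih =>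
    rw [pow_succ', mul_left_comm, extremalPositions_mul hb hd hdc h (by positivity), ih, dilate,
      dilate, dilate, Set.image_image]
    simp only [mul_assoc]

/-! ### Periods not divisible by the base -/

/-- At most one of `n` and `n + l` is a multiple of `b`, so the increment shared by the two
positions is `1`. -/
theorem HasPeriod.digitSumMod_succ (hb : 2 ≤ b) {p K l : ℕ} (hbl : ¬ b ∣ l)
    (h : HasPeriod (digitSumMod b m) p K l) {j : ℕ} (hj : j + 1 < K) :
    digitSumMod b m (p + j + 1) = digitSumMod b m (p + j) + 1 ∧
      digitSumMod b m (p + l + j + 1) = digitSumMod b m (p + l + j) + 1 := by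
  have h1 := h j (by omega)
  have h2 := h (j + 1) hj
  rw [add_right_comm] at h1
  rw [← add_assoc, show p + j + 1 + l = p + l + j + 1 by ring] at h2
  by_cases hd : b ∣ p + j + 1
  · have hd' : ¬ b ∣ p + l + j + 1 := by
      intro hd'
      rw [show p + l + j + 1 = l + (p + j + 1) by ring] at hd'
      exact hbl ((Nat.dvd_add_left hd).1 hd')
    have := digitSumMod_succ_of_not_dvd (m := m) hb hd'
    exact ⟨by rw [h2, this, h1], this⟩
  · have := digitSumMod_succ_of_not_dvd (m := m) hb hd
    exact ⟨this, by rw [← h2, this, h1]⟩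

theorem HasPeriod.sq_dvd (hb : 2 ≤ b) (haper : ¬ m ∣ b - 1) {p l : ℕ} (hbl : ¬ b ∣ l)
    (h : HasPeriod (digitSumMod b m) p l l) {n : ℕ} (hn : b ∣ n) (h1 : p < n)
    (h2 : n < p + 2 * l) (h3 : n ≠ p + l) : b ^ 2 ∣ n := by
  rcases lt_or_ge n (p + l) with h4 | h4
  · obtain ⟨j, rfl⟩ := Nat.exists_eq_add_of_lt h1
    exact sq_dvd_of_digitSumMod_succ hb haper hn (h.digitSumMod_succ hb hbl (by omega)).1
  · obtain ⟨j, rfl⟩ := Nat.exists_eq_add_of_lt (lt_of_le_of_ne h4 (Ne.symm h3))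
    exact sq_dvd_of_digitSumMod_succ hb haper hn (h.digitSumMod_succ hb hbl (by omega)).2

/-- The middle `k * b ^ q` of a square of length `2 * l` determines `l` modulo `m`: the increments
over one period add up to zero, and all but the one in the middle are `1`. -/
theorem HasPeriod.mul_eq (hb : 2 ≤ b) {p l : ℕ} (hl : 0 < l) (hbl : ¬ b ∣ l)
    (h : HasPeriod (digitSumMod b m) p l l) {k q : ℕ} (hk : ¬ b ∣ k)
    (hkq : p + l = k * b ^ q) : ((b : ZMod m) - 1) * q = l := by
  obtain ⟨l, rfl⟩ := Nat.exists_eq_add_of_lt hl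
  rw [zero_add] at *
  have h1 := digitSumMod_add (b := b) (m := m) (p := p) (n := l)
    fun j hj => (h.digitSumMod_succ hb hbl (by omega)).1
  have h2 := ThueMorse.digitSumMod_succ (m := m) hb hk q (p + l) hkq
  have h3 := h 0 (by omega)
  rw [add_zero] at h3
  rw [← add_assoc] at h3
  rw [h1, ← h3] at h2
  push_cast
  linear_combination h2

/-- A square whose period exceeds `b` has multiples of `b` on both sides of its middle; all of
them but the middle itself are multiples of `b ^ 2`, which leaves no room unless `b = 2`. -/
theorem HasPeriod.eq_of_lt (hb : 2 ≤ b) (haper : ¬ m ∣ b - 1) {p l : ℕ} (hbl : ¬ b ∣ l)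
    (h : HasPeriod (digitSumMod b m) p l l) (hlt : b < l) :
    b = 2 ∧ m = 2 ∧ l = 3 ∧ p % 4 = 3 := by
  have hb0 : 0 < b := by omega
  have hsq : ∀ {n}, b ^ 2 ∣ n → b ^ 2 ∣ n + b → False := by
    intro n h1 h2
    have := Nat.le_of_dvd hb0 ((Nat.dvd_add_right h1).1 h2)
    nlinarith
  obtain ⟨x, hx⟩ : ∃ x, x = b * ((p + l - 1) / b) := ⟨_, rfl⟩
  have hx1 := Nat.div_add_mod (p + l - 1) b
  have hx2 := Nat.mod_lt (p + l - 1) hb0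
  rw [← hx] at hx1
  have hbx : b ∣ x := ⟨_, hx⟩
  have hx4 := h.sq_dvd hb haper hbl hbx (by omega) (by omega) (by omega)
  have hmid : x + b = p + l := by
    by_contra hne
    exact hsq hx4 (h.sq_dvd hb haper hbl (hbx.add dvd_rfl) (by omega) (by omega) hne)
  have hx5 : b ^ 2 ∣ x + b + b :=
    h.sq_dvd hb haper hbl ((hbx.add dvd_rfl).add dvd_rfl) (by omega) (by omega) (by omega)
  have hb2 : b = 2 := by
    rw [add_assoc] at hx5
    have := Nat.le_of_dvd (by omega) ((Nat.dvd_add_right hx4).1 hx5)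
    nlinarith
  subst hb2
  have hl3 : l = 3 := by
    by_contra hne
    refine hsq (n := x - 2) (h.sq_dvd hb haper hbl (Nat.dvd_sub hbx dvd_rfl) ?_ ?_ ?_) ?_
    · omega
    · omega
    · omega
    · rw [Nat.sub_add_cancel (by omega)]
      exact hx4
  subst hl3
  have hm := h.mul_eq (k := (p + 3) / 2) (q := 1) hb (by norm_num) hbl (by omega) (by omega)
  have hm2 : m ∣ 2 := by
    rw [← ZMod.natCast_eq_zero_iff]
    push_cast at hm ⊢
    linear_combination -hm
  have := Nat.le_of_dvd (by norm_num) hm2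
  refine ⟨rfl, ?_, rfl, by omega⟩
  interval_cases m
  · norm_num at hm2
  · norm_num at haper
  · rfl

/-- The increment at a position that is not a multiple `c` of `b`, but closer than `b` to it,
is `1`. -/
theorem digitSumMod_succ_of_near {n c : ℕ} (hb : 2 ≤ b) (hc : b ∣ c) (h1 : n + 1 ≠ c)
    (h2 : n + 1 < c + b) (h3 : c < n + 1 + b) :
    digitSumMod b m (n + 1) = digitSumMod b m n + 1 := by
  refine digitSumMod_succ_of_not_dvd hb fun hn => ?_
  rcases lt_or_gt_of_ne h1 with h | h
  · have := Nat.le_of_dvd (by omega) (Nat.dvd_sub hc hn)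
    omega
  · have := Nat.le_of_dvd (by omega) (Nat.dvd_sub hn hc)
    omega

/-! ### Runs longer than two periods -/

/-- In a factor longer than two periods the two ranges on which increments are `1` cover the
whole factor. -/
theorem HasPeriod.digitSumMod_succ_of_lt (hb : 2 ≤ b) {p K l : ℕ} (hbl : ¬ b ∣ l)
    (h : HasPeriod (digitSumMod b m) p K l) (hlt : l < K) {j : ℕ} (hj : j + 1 < K + l) :
    digitSumMod b m (p + j + 1) = digitSumMod b m (p + j) + 1 := by
  rcases lt_or_ge (j + 1) K with h1 | h1
  · exact (h.digitSumMod_succ hb hbl h1).1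
  · obtain ⟨i, rfl⟩ := Nat.exists_eq_add_of_le (show l ≤ j by omega)
    rw [← add_assoc]
    exact (h.digitSumMod_succ hb hbl (by omega)).2

theorem HasPeriod.dvd_of_lt (hb : 2 ≤ b) {p K l : ℕ} (hbl : ¬ b ∣ l)
    (h : HasPeriod (digitSumMod b m) p K l) (hlt : l < K) : m ∣ l := by
  have h1 := digitSumMod_add (b := b) (m := m) (p := p) (n := l)
    fun j hj => h.digitSumMod_succ_of_lt hb hbl hlt (by omega)
  have h2 := h 0 (by omega)
  rw [add_zero, h1] at h2
  rw [← ZMod.natCast_eq_zero_iff]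
  exact left_eq_add.1 h2

theorem HasPeriod.not_dvd_add_of_lt (hb : 2 ≤ b) (haper : ¬ m ∣ b - 1) {p K l : ℕ}
    (hbl : ¬ b ∣ l) (h : HasPeriod (digitSumMod b m) p K l) (hlt : l < K) {n : ℕ} (h1 : p < n)
    (h2 : n + b < p + K + l) : ¬ b ∣ n := by
  intro hn
  have hsq : ∀ n, p < n → n < p + K + l → b ∣ n → b ^ 2 ∣ n := by
    intro n h1 h2 hn
    obtain ⟨j, rfl⟩ := Nat.exists_eq_add_of_lt h1
    exact sq_dvd_of_digitSumMod_succ hb haper hn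
      (h.digitSumMod_succ_of_lt hb hbl hlt (by omega))
  have h3 := hsq n h1 (by omega) hn
  have h4 := hsq (n + b) (by omega) h2 (hn.add dvd_rfl)
  have := Nat.le_of_dvd (by omega) ((Nat.dvd_add_right h3).1 h4)
  nlinarith

theorem exists_dvd_of_lt (hb : 2 ≤ b) (p : ℕ) : ∃ n, b ∣ n ∧ p < n ∧ n ≤ p + b := by
  have h1 := Nat.div_add_mod p b
  have h2 := Nat.mod_lt p (show b > 0 by omega)
  exact ⟨b * (p / b + 1), dvd_mul_right _ _, by rw [mul_add]; omega, by rw [mul_add]; omega⟩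

theorem HasPeriod.add_le_of_lt (hb : 2 ≤ b) (haper : ¬ m ∣ b - 1) {p K l : ℕ} (hbl : ¬ b ∣ l)
    (h : HasPeriod (digitSumMod b m) p K l) (hlt : l < K) : K + l ≤ 2 * b := by
  by_contra hcon
  obtain ⟨n, hn, h1, h2⟩ := exists_dvd_of_lt hb p
  exact h.not_dvd_add_of_lt hb haper hbl hlt h1 (by omega) hn

/-! ### Alphabets with fewer than `b` letters -/

theorem isPeriodBound_of_lt (hb : 2 ≤ b) (haper : ¬ m ∣ b - 1) (hmb : m < b) :
    IsPeriodBound (digitSumMod b m) (2 * b) m := by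
  refine isPeriodBound_of_not_dvd hb (by omega) fun p K l hbl h => ?_
  rcases lt_or_ge l K with hlt | hle
  · have h1 := h.add_le_of_lt hb haper hbl hlt
    have h2 : m ≤ l :=
      Nat.le_of_dvd (Nat.pos_of_ne_zero fun h => hbl (h ▸ dvd_zero b)) (h.dvd_of_lt hb hbl hlt)
    rw [mul_comm]
    exact Nat.mul_le_mul h1 h2
  · calc m * (K + l) ≤ b * (l + l) := by gcongr
      _ = 2 * b * l := by ring

theorem eq_of_mem_extremalPositions (hb : 2 ≤ b) (haper : ¬ m ∣ b - 1) (hmb : m < b)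
    {p K l : ℕ} (hbl : ¬ b ∣ l) (h : HasPeriod (digitSumMod b m) p K l)
    (he : m * (K + l) = 2 * b * l) : l < K ∧ l = m ∧ K + l = 2 * b := by
  have hl : 0 < l := Nat.pos_of_ne_zero fun h => hbl (h ▸ dvd_zero b)
  have hlt : l < K := by
    by_contra hle
    have : m * (K + l) < 2 * b * l := by
      calc m * (K + l) ≤ m * (l + l) := by gcongr; omega
        _ < b * (l + l) := by gcongr
        _ = 2 * b * l := by ring
    omega
  have h1 := h.add_le_of_lt hb haper hbl hlt
  have h2 : m ≤ l := Nat.le_of_dvd hl (h.dvd_of_lt hb hbl hlt)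
  have h3 : l ≤ m := by
    have : l * (2 * b) ≤ m * (2 * b) := by
      rw [mul_comm, ← he]
      gcongr
    exact Nat.le_of_mul_le_mul_right this (by omega)
  have h4 : l = m := le_antisymm h3 h2
  refine ⟨hlt, h4, ?_⟩
  rw [← h4, mul_comm] at he
  exact Nat.eq_of_mul_eq_mul_right hl he

theorem extremalPositions_eq_setA (hb : 2 ≤ b) (hm : 1 ≤ m) (haper : ¬ m ∣ b - 1) (hmb : m < b) :
    extremalPositions (digitSumMod b m) (2 * b) m m = setA b m := by
  have hbm : ¬ b ∣ m := fun h => absurd (Nat.le_of_dvd hm h) (by omega)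
  ext p
  constructor
  · rintro ⟨K, h, he⟩
    obtain ⟨hlt, -, hK⟩ := eq_of_mem_extremalPositions hb haper hmb hbm h he
    have hdvd : b ∣ p + b := by
      obtain ⟨n, hn, h1, h2⟩ := exists_dvd_of_lt hb p
      rcases h2.lt_or_eq with h3 | rfl
      · exact absurd hn (h.not_dvd_add_of_lt hb haper hbm hlt h1 (by omega))
      · exact hn
    obtain ⟨k, q, hk0, hk, hkq⟩ := exists_eq_mul_pow hb (show 0 < p + b by omega)
    have h1 := h.digitSumMod_succ_of_lt hb hbm hlt (j := b - 1) (by omega)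
    rw [digitSumMod_succ hb hk q _ (by omega), sub_eq_self] at h1
    refine ⟨k, q, hk0, hk, mem_bezoutSet_iff.2 ⟨Nat.pos_of_ne_zero ?_, by simpa using h1⟩, ?_⟩
    · rintro rfl
      rw [pow_zero, mul_one] at hkq
      exact hk (hkq ▸ hdvd)
    · rw [eq_sub_iff_add_eq]
      exact_mod_cast hkq
  · rintro ⟨k, q, hk0, hk, hq, hp⟩
    obtain ⟨hq0, hq⟩ := mem_bezoutSet_iff.1 hq
    have hpb : p + b = k * b ^ q := by
      rw [eq_sub_iff_add_eq] at hp
      exact_mod_cast hp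
    have hdvd : b ∣ p + b := hpb ▸ Dvd.dvd.mul_left (dvd_pow_self b hq0.ne') k
    have hone : ∀ j, j + 1 < 2 * b →
        digitSumMod b m (p + j + 1) = digitSumMod b m (p + j) + 1 := by
      intro j hj
      by_cases hjb : p + j + 1 = p + b
      · rw [digitSumMod_succ hb hk q _ (hjb.trans hpb), hq]
        simp
      · exact digitSumMod_succ_of_near hb hdvd hjb (by omega) (by omega)
    refine ⟨2 * b - m, fun j hj => ?_, ?_⟩
    · rw [digitSumMod_add (p := p + j) (n := m) fun i hi => ?_]
      · simp
      · rw [add_assoc p j i]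
        exact hone _ (by omega)
    · rw [Nat.sub_add_cancel (by omega), mul_comm]

theorem setA_nonempty (hb : 2 ≤ b) (hm : 1 ≤ m) : (setA b m).Nonempty := by
  have h : b ≤ b ^ m := Nat.le_self_pow (by omega) b
  refine ⟨b ^ m - b, 1, m, one_pos, by rw [Nat.dvd_one]; omega,
    mem_bezoutSet_iff.2 ⟨hm, by simp⟩, ?_⟩
  push_cast [h]
  ring

/-! ### Alphabets with at least `b` letters -/

theorem isPeriodBound_of_le (hb : 2 ≤ b) (haper : ¬ m ∣ b - 1) (hbm : b ≤ m) :
    IsPeriodBound (digitSumMod b m) 2 1 := by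
  refine isPeriodBound_of_not_dvd hb (by norm_num) fun p K l hbl h => ?_
  by_contra hcon
  have hlt : l < K := by omega
  have h1 := h.add_le_of_lt hb haper hbl hlt
  have h2 : m ≤ l :=
    Nat.le_of_dvd (Nat.pos_of_ne_zero fun h => hbl (h ▸ dvd_zero b)) (h.dvd_of_lt hb hbl hlt)
  omega

theorem mem_extremalPositions_two_one {A : Type*} {x : ℕ → A} {l p : ℕ} :
    p ∈ extremalPositions x 2 1 l ↔ HasPeriod x p l l := by
  constructor
  · rintro ⟨K, h, he⟩
    rwa [show K = l by omega] at h
  · exact fun h => ⟨l, h, by omega⟩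

theorem extremalPositions_eq_setB (hb : 2 ≤ b) (hbm : b ≤ m) {l : ℕ} (hl : 0 < l) (hlb : l < b) :
    extremalPositions (digitSumMod b m) 2 1 l = setB b m l := by
  have hbl : ¬ b ∣ l := fun h => absurd (Nat.le_of_dvd hl h) (by omega)
  ext p
  rw [mem_extremalPositions_two_one]
  constructor
  · intro h
    obtain ⟨k, q, hk0, hk, hkq⟩ := exists_eq_mul_pow hb (show 0 < p + l by omega)
    have h1 := h.mul_eq hb hl hbl hk hkq
    refine ⟨k, q, hk0, hk, mem_bezoutSet_iff.2 ⟨Nat.pos_of_ne_zero ?_, h1⟩, ?_⟩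
    · -- `q = 0` would force `m ∣ l`, although `0 < l < b ≤ m`
      rintro rfl
      rw [Nat.cast_zero, mul_zero, eq_comm, ZMod.natCast_eq_zero_iff] at h1
      have := Nat.le_of_dvd hl h1
      omega
    · rw [eq_sub_iff_add_eq]
      exact_mod_cast hkq
  · rintro ⟨k, q, hk0, hk, hq, hp⟩
    obtain ⟨hq0, hq⟩ := mem_bezoutSet_iff.1 hq
    have hpl : p + l = k * b ^ q := by
      rw [eq_sub_iff_add_eq] at hp
      exact_mod_cast hp
    have hdvd : b ∣ p + l := hpl ▸ Dvd.dvd.mul_left (dvd_pow_self b hq0.ne') k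
    have hone : ∀ j, j + 1 < 2 * l → j + 1 ≠ l →
        digitSumMod b m (p + j + 1) = digitSumMod b m (p + j) + 1 :=
      fun j hj hjl =>
        digitSumMod_succ_of_near hb hdvd (by omega) (by omega) (by omega)
    obtain ⟨c, rfl⟩ := Nat.exists_eq_add_of_lt hl
    simp only [zero_add] at *
    have h1 := digitSumMod_add (p := p) (n := c) fun j hj => hone j (by omega) (by omega)
    have h2 := digitSumMod_succ (m := m) hb hk q (p + c) hpl
    rw [hq, h1] at h2
    have h3 : digitSumMod b m (p + (c + 1)) = digitSumMod b m p := by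
      rw [← add_assoc, h2]
      push_cast
      ring
    intro j hj
    rw [digitSumMod_add fun i hi => hone i (by omega) (by omega), add_right_comm p j,
      digitSumMod_add (p := p + (c + 1)) fun i hi => ?_, h3]
    rw [add_assoc p (c + 1) i]
    exact hone _ (by omega) (by omega)

theorem one_mem_setB (hb : 2 ≤ b) : 1 ∈ setB b m (b - 1) := by
  refine ⟨1, 1, one_pos, by rw [Nat.dvd_one]; omega, mem_bezoutSet_iff.2 ⟨one_pos, ?_⟩, ?_⟩
  · push_cast [show 1 ≤ b by omega]
    ring
  · push_cast [show 1 ≤ b by omega]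
    ring

/-! ### The binary Thue-Morse word -/

theorem hasPeriod_three_iff {p : ℕ} :
    HasPeriod (digitSumMod 2 2) p 3 3 ↔ p % 4 = 3 ∧
      digitSumMod 2 2 (p + 1) = digitSumMod 2 2 p + 1 ∧
      digitSumMod 2 2 (p + 4 + 1) = digitSumMod 2 2 (p + 4) + 1 := by
  have hb : 2 ≤ 2 := le_rfl
  have two : (2 : ZMod 2) = 0 := rfl
  constructor
  · intro h
    exact ⟨(h.eq_of_lt hb (by norm_num) (by norm_num) (by norm_num)).2.2.2,
      (h.digitSumMod_succ hb (by norm_num) (j := 0) (by norm_num)).1,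
      (h.digitSumMod_succ hb (by norm_num) (j := 1) (by norm_num)).2⟩
  · rintro ⟨hp, h1, h5⟩
    have h2 := digitSumMod_succ_of_not_dvd (m := 2) hb (n := p + 1) (by omega)
    have h3 := digitSumMod_succ (m := 2) hb (k := (p + 3) / 2) (by omega) 1 (p + 2) (by omega)
    have h4 := digitSumMod_succ_of_not_dvd (m := 2) hb (n := p + 3) (by omega)
    simp only [add_assoc, Nat.reduceAdd] at h1 h2 h3 h4 h5
    intro j hj
    interval_cases j
    · simp only [add_assoc, Nat.reduceAdd]
      rw [add_zero, h3, h2, h1]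
      push_cast
      linear_combination -two
    · simp only [add_assoc, Nat.reduceAdd]
      rw [h4, h3, h2]
      push_cast
      linear_combination -two
    · simp only [add_assoc, Nat.reduceAdd]
      rw [h5, h4, h3]
      push_cast
      linear_combination -two

theorem mem_setB_one_iff {n c : ℕ} (hc : c + 1 = 8 * (n + 1)) :
    digitSumMod 2 2 (c + 1) = digitSumMod 2 2 c + 1 ↔ n ∈ setB 2 2 1 := by
  have key : ∀ {k q : ℕ}, ¬ 2 ∣ k → n + 1 = k * 2 ^ q →
      (digitSumMod 2 2 (c + 1) = digitSumMod 2 2 c + 1 ↔ (q : ZMod 2) = 1) := by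
    intro k q hk hkq
    rw [digitSumMod_succ le_rfl hk (q + 3) c (by rw [hc, hkq]; ring), sub_eq_self]
    push_cast
    generalize (q : ZMod 2) = y
    revert y
    decide
  constructor
  · intro h
    obtain ⟨k, q, hk0, hk, hkq⟩ := exists_eq_mul_pow le_rfl (Nat.succ_pos n)
    have hq := (key hk hkq).1 h
    refine ⟨k, q, hk0, hk, mem_bezoutSet_iff.2 ⟨Nat.pos_of_ne_zero ?_, ?_⟩, ?_⟩
    · rintro rfl
      simp at hq
    · rw [hq]
      decide
    · rw [eq_sub_iff_add_eq]
      exact_mod_cast hkq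
  · rintro ⟨k, q, -, hk, hq, hp⟩
    rw [eq_sub_iff_add_eq] at hp
    refine (key hk (by exact_mod_cast hp)).2 ?_
    have h1 := (mem_bezoutSet_iff.1 hq).2
    push_cast at h1
    generalize (q : ZMod 2) = y at *
    revert y
    decide

theorem extremalPositions_eq_setC :
    extremalPositions (digitSumMod 2 2) 2 1 3 = setC 2 2 := by
  -- at odd multiples of `4` the increment is `1 - 2 = 1` modulo `2`
  have four : ∀ c, (c + 1) % 8 = 4 → digitSumMod 2 2 (c + 1) = digitSumMod 2 2 c + 1 := by
    intro c hc
    rw [digitSumMod_succ le_rfl (k := (c + 1) / 4) (by omega) 2 c (by omega), sub_eq_self]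
    decide
  ext p
  rw [mem_extremalPositions_two_one, hasPeriod_three_iff]
  constructor
  · rintro ⟨hp, h1, h5⟩
    rcases (show p % 8 = 3 ∨ p % 8 = 7 by omega) with h | h
    · exact Or.inl ⟨p / 8, (mem_setB_one_iff (by omega)).1 h5, by dsimp only; omega⟩
    · exact Or.inr ⟨p / 8, (mem_setB_one_iff (by omega)).1 h1, by dsimp only; omega⟩
  · rintro (⟨n, hn, rfl⟩ | ⟨n, hn, rfl⟩)
    · exact ⟨by dsimp only; omega, four _ (by dsimp only; omega),
        (mem_setB_one_iff (by dsimp only; omega)).2 hn⟩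
    · exact ⟨by dsimp only; omega, (mem_setB_one_iff (by dsimp only; omega)).2 hn,
        four _ (by dsimp only; omega)⟩

end ThueMorse

open ThueMorse in
theorem theorem2 (b m : ℕ) (hb : 2 ≤ b) (hm : 1 ≤ m)
    {A : Type*} [Fintype A] (hA : Fintype.card A = m)
    (σ : Equiv.Perm A) (hσ : σ.IsCycleOn Set.univ) (a : A)
    (haper : ¬ m ∣ b - 1)
    (w : List A) (hw : ThueMorse.IsCriticalFactor (ThueMorse.word b σ a) w)
    (N i : ℕ) (hlen : w.length = N * b ^ i) (hN : ¬ b ∣ N) :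
    (m < b →
      ThueMorse.criticalOccurrences (ThueMorse.word b σ a) (N * b ^ i) =
        ThueMorse.dilate (b ^ i) (ThueMorse.setA b m)) ∧
    (b ≤ m → (b, m) ≠ (2, 2) →
      ThueMorse.criticalOccurrences (ThueMorse.word b σ a) (N * b ^ i) =
        ThueMorse.dilate (b ^ i) (ThueMorse.setB b m N)) ∧
    (b = 2 → m = 2 →
      (⋃ (M : ℕ) (_ : ¬ b ∣ M),
          ThueMorse.criticalOccurrences (ThueMorse.word b σ a) (M * b ^ i)) =
        ThueMorse.dilate (b ^ i) (ThueMorse.setB b m 1 ∪ ThueMorse.setC b m) ∧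
      ((N = 1 ∧ ThueMorse.criticalOccurrences (ThueMorse.word b σ a) (N * b ^ i) =
          ThueMorse.dilate (b ^ i) (ThueMorse.setB b m 1)) ∨
       (N = 3 ∧ ThueMorse.criticalOccurrences (ThueMorse.word b σ a) (N * b ^ i) =
          ThueMorse.dilate (b ^ i) (ThueMorse.setC b m)))) := by
  have hpos : ∀ {M}, ¬ b ∣ M → 0 < M := fun h => Nat.pos_of_ne_zero fun h0 => h (h0 ▸ dvd_zero b)
  have hext : ∀ c d l, extremalPositions (word b σ a) c d l =
      extremalPositions (digitSumMod b m) c d l := by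
    intro c d l
    simp only [extremalPositions, hasPeriod_word_iff hb hA hσ]
  -- a period bound attained somewhere reduces the claim to the extremal positions for period `N`
  have main : ∀ c d l, 0 < d → d < c → IsPeriodBound (digitSumMod b m) c d → 0 < l →
      (extremalPositions (digitSumMod b m) c d l).Nonempty →
      (∀ M, 0 < M → criticalOccurrences (word b σ a) (M * b ^ i) =
        dilate (b ^ i) (extremalPositions (digitSumMod b m) c d M)) ∧
      (extremalPositions (digitSumMod b m) c d N).Nonempty := by
    intro c d l hd hdc hbound hl hne
    have hbound' : IsPeriodBound (word b σ a) c d := fun p K l hl h =>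
      hbound p K l hl ((hasPeriod_word_iff hb hA hσ a).1 h)
    have he := hbound'.criticalExponent_eq hd hdc.le hl (by rwa [hext])
    have hdil := fun M hM => extremalPositions_mul_pow (l := M) hb hd hdc hbound hM i
    refine ⟨fun M hM => ?_, ?_⟩
    · rw [hbound'.criticalOccurrences_eq hd hdc.le he (by positivity), hext, hdil M hM]
    · have hN0 := hpos hN
      have h := hbound'.extremalPositions_nonempty hd hdc.le he (by rw [hlen]; positivity) hw
      rw [hlen, hext, hdil N hN0, dilate, Set.image_nonempty] at h
      exact h
  have mainB : b ≤ m → (∀ M, 0 < M → criticalOccurrences (word b σ a) (M * b ^ i) =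
        dilate (b ^ i) (extremalPositions (digitSumMod b m) 2 1 M)) ∧
      (extremalPositions (digitSumMod b m) 2 1 N).Nonempty := fun hbm =>
    main 2 1 (b - 1) one_pos one_lt_two (isPeriodBound_of_le hb haper hbm) (by omega)
      ⟨1, by rw [extremalPositions_eq_setB hb hbm (by omega) (by omega)]; exact one_mem_setB hb⟩
  have short : ∀ {M}, ¬ b ∣ M → (extremalPositions (digitSumMod b m) 2 1 M).Nonempty →
      M < b ∨ b = 2 ∧ m = 2 ∧ M = 3 := by
    rintro M hM ⟨p, hp⟩
    rw [mem_extremalPositions_two_one] at hp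
    have hne : M ≠ b := fun h => hM (h ▸ dvd_rfl)
    rcases lt_or_gt_of_ne hne with h | h
    · exact Or.inl h
    · obtain ⟨h1, h2, h3, -⟩ := hp.eq_of_lt hb haper hM h
      exact Or.inr ⟨h1, h2, h3⟩
  refine ⟨fun hmb => ?_, fun hbm hne => ?_, ?_⟩
  · have hA' := extremalPositions_eq_setA hb hm haper hmb
    obtain ⟨h1, p, K, hK, he⟩ := main (2 * b) m m hm (by omega)
      (isPeriodBound_of_lt hb haper hmb) hm (by rw [hA']; exact setA_nonempty hb hm)
    rw [h1 N (hpos hN), (eq_of_mem_extremalPositions hb haper hmb hN hK he).2.1, hA']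
  · obtain ⟨h1, h2⟩ := mainB hbm
    rcases short hN h2 with h | ⟨h3, h4, -⟩
    · rw [h1 N (hpos hN), extremalPositions_eq_setB hb hbm (hpos hN) h]
    · exact absurd (by rw [h3, h4]) hne
  · rintro rfl rfl
    obtain ⟨h1, h2⟩ := mainB le_rfl
    have hone := h1 1 one_pos
    rw [extremalPositions_eq_setB hb le_rfl one_pos one_lt_two] at hone
    have hthree := h1 3 (by norm_num)
    rw [extremalPositions_eq_setC] at hthree
    constructor
    · rw [dilate, Set.image_union]
      apply Set.Subset.antisymm
      · refine Set.iUnion₂_subset fun M hM p hp => ?_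
        have hp' := hp
        rw [h1 M (hpos hM), dilate] at hp'
        rcases short hM (Set.image_nonempty.1 ⟨p, hp'⟩) with h | ⟨-, -, rfl⟩
        · obtain rfl : M = 1 := by omega
          exact Or.inl (hone.subset hp)
        · exact Or.inr (hthree.subset hp)
      · refine Set.union_subset ?_ ?_
        · exact hone.symm.subset.trans (Set.subset_iUnion₂_of_subset 1 (by norm_num) le_rfl)
        · exact hthree.symm.subset.trans (Set.subset_iUnion₂_of_subset 3 (by norm_num) le_rfl)
    · rcases short hN h2 with h | ⟨-, -, rfl⟩
      · obtain rfl : N = 1 := by have := hpos hN; omega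
        exact Or.inl ⟨rfl, hone⟩
      · exact Or.inr ⟨rfl, hthree⟩
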